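/- **Setting.** Fix integers $n \ge 1$ (bins) and $b \ge 1$ (batch size) and a weight distribution $\mathcal W$ on $[0,\infty)$. For $S \ge 1$, $\mathcal W$ is a $\mathrm{FiniteMgf}(S)$ distribution if $\mathbb E[\mathcal W]=1$ and there is $\zeta>0$ with $\mathbb E[e^{\zeta \mathcal W}]<\infty$, $S\ge\max\{1,1/\zeta\}$ and $$\mathbb E[e^{\gamma\kappa \mathcal W}] \le 1+\gamma\kappa+S\gamma^2\kappa^2\qquad\text{for all } \gamma\in(0,\min\{\zeta/2,1\}),\ \kappa\in[-1,1].$$ In the *weighted batched setting*, $y^0=0\in\mathbb R^n$, and for each $t=0,b,2b,\dots$, given the history $\mathfrak F^t$ up to step $t$ and an $\mathfrak F^t$-measurable probability vector $p^t=(p^t_1,\dots,p^t_n)$, one samples independently $b$ indices $i_1,\dots,i_b\in[n]$ with distribution $p^t$ and $b$ weights $w^{t+1},\dots,w^{t+b}$ with distribution $\mathcal W$, and lets $y^{t+b}$ be the decreasing rearrangement of the vector $z^{t+b}$ with $$z_i^{t+b}=y_i^t+\sum_{j=1}^b w^{t+j}\mathbf 1_{i_j=i}-\frac1n\sum_{j=1}^b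 w^{t+j},\qquad i\in[n].$$ So $y^t$ is the sorted vector of normalized loads, and $p_i^t$ is the probability of allocating a ball to the $i$-th heaviest bin. **Conditions on a probability vector $p$.** - $\mathcal C_1$ with $\delta,\varepsilon\in(0,1)$: $\sum_{i=1}^k p_i\le(1-\varepsilon)\frac kn$ for all integers $1\le k\le\delta n$, and $\sum_{i=k}^n p_i\ge\bigl(1+\varepsilon\frac{\delta}{1-\delta}\bigr)\frac{n-k+1}{n}$ for all integers $\delta n+1\le k\le n$. - $\mathcal C_3$ with $C>1$: $\max_{i\in[n]}\bigl|p_i-\frac1n\bigr|\le\frac{C-1}{n}$. **Theorem.** For every $\delta\in(0,1)$ there is a constant $k=k(\delta)>0$ such that the following holds for all $n\ge1$, $\varepsilon\in(0,1)$, $C\in(1,1.9)$, $S\ge1$, every $\mathrm{FiniteMgf}(S)$ distribution $\mathcal W$, and every integer $b\ge\frac{2CS}{(C-1)^2}\,n$. Consider any allocation process in the weighted batched setting with batch size $b$ and weights from $\mathcal W$ whose allocation vectors $p^t$ all satisfy $\mathcal C_1$ with $\delta,\varepsilon$ and $\mathcal C_3$ with $C$, almost surely. Then for every $m\ge0$ that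 is a multiple of $b$, $$\Pr\Bigl[\max_{i\in[n]}|y_i^m|\le k\cdot\frac{(C-1)^2}{\varepsilon}\cdot\frac bn\cdot\log n\Bigr]\ge1-n^{-2}.$$ -/

import Mathlib

open MeasureTheory ProbabilityTheory

/-- `W` is a `FiniteMgf(S)` weight distribution: a probability distribution on `[0, ∞)` with mean
`1` such that, for some `ζ > 0`, the moment generating function is finite at `ζ`,
`S ≥ max {1, 1/ζ}`, and the second-order moment bound with constant `S` holds for all
`γ ∈ (0, min {ζ/2, 1})` and `κ ∈ [-1, 1]`.
(`mgf id W s` is the integral of `exp (s * x)` against `W`.) -/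
structure FiniteMgf (S : ℝ) (W : Measure ℝ) : Prop where
  isProbabilityMeasure : IsProbabilityMeasure W
  nonneg : ∀ᵐ x ∂W, 0 ≤ x
  mean_eq_one : ∫ x, x ∂W = 1
  moment_bound : ∃ ζ : ℝ, 0 < ζ ∧ Integrable (fun x : ℝ => Real.exp (ζ * x)) W ∧
    max 1 (1 / ζ) ≤ S ∧
    ∀ γ : ℝ, 0 < γ → γ < min (ζ / 2) 1 → ∀ κ ∈ Set.Icc (-1 : ℝ) 1,
      mgf id W (γ * κ) ≤ 1 + γ * κ + S * γ ^ 2 * κ ^ 2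

/-- Condition `C₁` with quantile `δ` and bias `ε`. The entry `p i` with `i : Fin n` is the
probability of the `(i + 1)`-st heaviest bin, so with 1-based ranks the first sum runs over the
ranks `1, …, k` and the second over the ranks `k, …, n`. -/
def CondC1 {n : ℕ} (δ ε : ℝ) (p : Fin n → ℝ) : Prop :=
  (∀ k : ℕ, 1 ≤ k → (k : ℝ) ≤ δ * n →
    ∑ i : Fin n with i.val + 1 ≤ k, p i ≤ (1 - ε) * (k / n)) ∧
  (∀ k : ℕ, δ * n + 1 ≤ (k : ℝ) → k ≤ n →
    (1 + ε * (δ / (1 - δ))) * (((n : ℝ) - k + 1) / n) ≤ ∑ i : Fin n with k ≤ i.val + 1, p i)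

/-- Condition `C₃`: every entry of `p` is within `(C - 1) / n` of the uniform value `1 / n`. -/
def CondC3 {n : ℕ} (C : ℝ) (p : Fin n → ℝ) : Prop :=
  ∀ i, |p i - 1 / n| ≤ (C - 1) / n

/-- The vector `z` sorted decreasingly. -/
noncomputable def sortDesc {n : ℕ} (z : Fin n → ℝ) : Fin n → ℝ :=
  fun i => z (Tuple.sort (fun j => -z j) i)

/-- The normalized loads after one batch, before re-sorting: starting from the vector `y`, the
`j`-th ball of the batch, of weight `w j`, goes to entry `i j`. -/
noncomputable def batchUpdate {n b : ℕ} (y : Fin n → ℝ) (i : Fin b → Fin n) (w : Fin b → ℝ) :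
    Fin n → ℝ :=
  fun l => y l + (∑ j, if i j = l then w j else 0) - (1 / n) * ∑ j, w j

/-- An allocation process in the weighted batched setting, with `n` bins, batch size `b` and weight
distribution `W`, on a probability space `(Ω, μ)`. Time is counted in batches: index `r` stands for
the step `t = r * b`. The allocation vector used for a batch may be random, depending
on everything that is known when the batch begins. -/
structure BatchedProcess (n b : ℕ) (W : Measure ℝ) {Ω : Type*} [mΩ : MeasurableSpace Ω]
    (μ : Measure Ω) where
  /-- The information available at step `r * b`. -/
  ℱ : Filtration ℕ mΩ
  /-- `y r` is the decreasingly sorted, normalized load vector at step `r * b`. -/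
  y : ℕ → Ω → Fin n → ℝ
  /-- `p r` is the allocation vector used for the balls `r * b + 1, …, r * b + b`;
  its entries are indexed by rank, heaviest bin first. -/
  p : ℕ → Ω → Fin n → ℝ
  /-- `bin r j` is the rank (at step `r * b`) of the bin chosen by ball `r * b + j + 1`. -/
  bin : ℕ → Ω → Fin b → Fin n
  /-- `weight r j` is the weight of ball `r * b + j + 1`. -/
  weight : ℕ → Ω → Fin b → ℝ
  measurable_y : ∀ r, Measurable[ℱ r] (y r)
  measurable_p : ∀ r, Measurable[ℱ r] (p r)
  measurable_bin : ∀ r, Measurable[ℱ (r + 1)] (bin r)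
  measurable_weight : ∀ r, Measurable[ℱ (r + 1)] (weight r)
  /-- Each `p r` is a probability vector. -/
  p_mem : ∀ r ω, p r ω ∈ stdSimplex ℝ (Fin n)
  /-- All bins are empty at the beginning. -/
  y_zero : ∀ ω, y 0 ω = 0
  y_succ : ∀ r ω, y (r + 1) ω = sortDesc (batchUpdate (y r ω) (bin r ω) (weight r ω))
  /-- Conditionally on `ℱ r`, the `b` chosen ranks are independent with distribution `p r`, the `b`
  weights are independent with distribution `W`, and ranks and weights are independent. -/
  condLaw : ∀ (r : ℕ) (A : Set Ω), MeasurableSet[ℱ r] A →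
    ∀ (i : Fin b → Fin n) (B : Set (Fin b → ℝ)), MeasurableSet B →
      μ (A ∩ {ω | bin r ω = i ∧ weight r ω ∈ B}) =
        (∫⁻ ω in A, ∏ j, ENNReal.ofReal (p r ω (i j)) ∂μ) * Measure.pi (fun _ => W) B

/-! ### Hyperbolic functions -/

/-! The proof follows the potential `Γ = ∑ 2 cosh (γ yᵢ)`, with `γ` of order `δε n / ((C - 1)² b)`,
and shows that its mean stays below `4n`. Markov's inequality at level `4n³` then fails with
probability at most `n⁻²`, and `Γ < 4n³` forces `γ |yᵢ| ≤ 5 log n`.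

Write `a = δε` and `η = γ b / n`. Given the past, the balls of a batch are independent, so `exp (±γ
yᵢ)` is multiplied in mean by the `b`-th power of a one-ball factor. The moment bound on the weights
and `C₃` bound this power by `1 ± bγ (pᵢ - 1/n) + 4 (η (C - 1))²`; the lower bound on `b` is what
makes the variance of the batch at most `(η (C - 1))²`. Hence the mean of `Γ` changes by at most `4
(η (C - 1))² Γ + bγ ∑ 2 sinh (γ yᵢ) (pᵢ - 1/n)`.

The last sum is negative for large `Γ`. By `C₁`, the prefix sums of `p - 1/n` lie below those of
`-(a/n) s`, where `s` is the sign of the upper half minus the lower half. As `sinh (γ yᵢ)` decreases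
in `i`, summation by parts replaces `p - 1/n` by `-(a/n) s` (`CondC1.sum_mul_le`). Since `∑ yᵢ = 0`,
`IsMedianSign.sum_abs_sinh_le` bounds `∑ |sinh|` by `2 ∑ s sinh`, and `cosh ≤ |sinh| + 1` brings `Γ`
back. With `16 (η (C - 1))² ≤ ηa` this gives `E Γ' ≤ (1 - ηa/4) E Γ + ηa n`, whose fixed point is
`4n`. -/

theorem sinh_add_sinh_le {u v : ℝ} (hu : 0 ≤ u) (hvu : v ≤ u) :
    Real.sinh u + Real.sinh v ≤ (v + u) * Real.cosh u := by
  rcases le_total (-u) v with h | h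
  -- Mean value inequality on `[-u, v]`, where `cosh ≤ cosh u`.
  · have := (convex_Icc (-u) u).image_sub_le_mul_sub_of_deriv_le (f := Real.sinh)
      (C := Real.cosh u) Real.continuous_sinh.continuousOn
      Real.differentiable_sinh.differentiableOn (by
        intro x hx
        rw [interior_Icc] at hx
        rw [Real.deriv_sinh, Real.cosh_le_cosh, abs_of_nonneg hu]
        exact abs_le.2 ⟨hx.1.le, hx.2.le⟩)
      (-u) ⟨le_rfl, by linarith⟩ v ⟨h, hvu⟩ h
    rw [Real.sinh_neg] at this
    linarith
  -- Now both sides are at most zero: on `[v, -u]` the slope of `sinh` is at least `cosh u`.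
  · have := (convex_Icc v (-u)).mul_sub_le_image_sub_of_le_deriv (f := Real.sinh)
      (C := Real.cosh u) Real.continuous_sinh.continuousOn
      Real.differentiable_sinh.differentiableOn (by
        intro x hx
        rw [interior_Icc] at hx
        rw [Real.deriv_sinh, Real.cosh_le_cosh, abs_of_nonneg hu, abs_of_neg (by linarith [hx.2])]
        linarith [hx.2])
      v ⟨le_rfl, h⟩ (-u) ⟨h, le_rfl⟩ h
    rw [Real.sinh_neg] at this
    linarith

theorem sinh_le_mul_cosh {u : ℝ} (hu : 0 ≤ u) : Real.sinh u ≤ u * Real.cosh u := by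
  simpa using sinh_add_sinh_le hu hu

/-- `s` is `1` above the median, `-1` below it and `0` at it. -/
def IsMedianSign {ι : Type*} (s u : ι → ℝ) (m : ℝ) : Prop :=
  ∀ i, (s i = 1 ∧ m ≤ u i) ∨ (s i = -1 ∧ u i ≤ m) ∨ (s i = 0 ∧ u i = m)

theorem IsMedianSign.neg {ι : Type*} {s u : ι → ℝ} {m : ℝ} (h : IsMedianSign s u m) :
    IsMedianSign (-s) (-u) (-m) := by
  intro i
  simp only [Pi.neg_apply]
  rcases h i with ⟨h1, h2⟩ | ⟨h1, h2⟩ | ⟨h1, h2⟩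
  · exact Or.inr (Or.inl ⟨by rw [h1], by linarith⟩)
  · exact Or.inl ⟨by rw [h1]; norm_num, by linarith⟩
  · exact Or.inr (Or.inr ⟨by rw [h1]; norm_num, by rw [h2]⟩)

/-- A positive median could make the signed sum small, because much of the lower half may be
positive too. The constraint `∑ u = 0` excludes this: the tangent-type bound `sinh u + sinh m ≤ (u +
m) cosh m` for `u ≤ m` charges the loss to a linear term that sums to zero. -/
theorem IsMedianSign.sum_abs_sinh_le_of_nonneg {ι : Type*} [Fintype ι] {s u : ι → ℝ} {m : ℝ}
    (h : IsMedianSign s u m) (hm : 0 ≤ m) (hs : ∑ i, s i = 0) (hu : ∑ i, u i = 0) :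
    ∑ i, |Real.sinh (u i)| ≤ 2 * ∑ i, s i * Real.sinh (u i) := by
  have hm0 : 0 ≤ Real.sinh m := Real.sinh_nonneg_iff.2 hm
  have hmc := sinh_le_mul_cosh hm
  have hc := Real.cosh_pos m
  -- The two correction terms are multiples of `u i` and `s i`, with coefficients independent of
  -- `i`, so they vanish on summation.
  have key : ∀ i, |Real.sinh (u i)| ≤ 2 * (s i * Real.sinh (u i)) + u i * Real.cosh m
      - s i * (m * Real.cosh m + Real.sinh m) := by
    intro i
    have tri : |Real.sinh (u i)| ≤ |Real.sinh (u i) - Real.sinh m| + Real.sinh m := by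
      have := abs_add_le (Real.sinh (u i) - Real.sinh m) (Real.sinh m)
      rwa [sub_add_cancel, abs_of_nonneg hm0] at this
    rcases h i with ⟨h1, h2⟩ | ⟨h1, h2⟩ | ⟨h1, h2⟩
    · have := Real.sinh_le_sinh.2 h2
      rw [abs_of_nonneg (sub_nonneg.2 this)] at tri
      rw [h1]
      nlinarith
    · have := Real.sinh_le_sinh.2 h2
      rw [abs_of_nonpos (sub_nonpos.2 this)] at tri
      have := sinh_add_sinh_le hm h2
      rw [h1]
      nlinarith
    · rw [h2, sub_self, abs_zero] at tri
      rw [h1, h2]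
      linarith
  calc ∑ i, |Real.sinh (u i)| ≤ ∑ i, (2 * (s i * Real.sinh (u i)) + u i * Real.cosh m
      - s i * (m * Real.cosh m + Real.sinh m)) := Finset.sum_le_sum fun i _ => key i
    _ = 2 * ∑ i, s i * Real.sinh (u i) := by
      rw [Finset.sum_sub_distrib, Finset.sum_add_distrib, ← Finset.sum_mul, ← Finset.sum_mul, hs,
        hu, Finset.mul_sum]
      ring

theorem IsMedianSign.sum_abs_sinh_le {ι : Type*} [Fintype ι] {s u : ι → ℝ} {m : ℝ}
    (h : IsMedianSign s u m) (hs : ∑ i, s i = 0) (hu : ∑ i, u i = 0) :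
    ∑ i, |Real.sinh (u i)| ≤ 2 * ∑ i, s i * Real.sinh (u i) := by
  rcases le_total 0 m with hm | hm
  · exact h.sum_abs_sinh_le_of_nonneg hm hs hu
  · have := h.neg.sum_abs_sinh_le_of_nonneg (by linarith) (by simp [hs]) (by simp [hu])
    simpa [Real.sinh_neg] using this

theorem two_mul_cosh_le (u : ℝ) : 2 * Real.cosh u ≤ 2 * |Real.sinh u| + 2 := by
  have h := Real.cosh_sq u
  nlinarith [Real.cosh_pos u, abs_nonneg (Real.sinh u), sq_abs (Real.sinh u)]

/-- Used with `u` the mean drift of a whole batch and `x ^ 2` its variance bound. Since `|u + x²| ≤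
3x/2 ≤ 1`, the second-order Taylor bound costs `9x²/4`, for a total of `13x²/4`. -/
theorem exp_add_sq_le {u x : ℝ} (hx : x ≤ 1 / 2) (hu : |u| ≤ x) :
    Real.exp (u + x ^ 2) ≤ 1 + u + 4 * x ^ 2 := by
  have hx0 : 0 ≤ x := (abs_nonneg u).trans hu
  have h1 : |u + x ^ 2| ≤ 3 / 2 * x := by
    refine (abs_add_le _ _).trans ?_
    rw [abs_of_nonneg (sq_nonneg x)]
    nlinarith
  have h2 := Real.abs_exp_sub_one_sub_id_le (x := u + x ^ 2) (h1.trans (by linarith))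
  have h3 : (u + x ^ 2) ^ 2 ≤ (3 / 2 * x) ^ 2 := sq_le_sq' (by linarith [(abs_le.1 h1).1])
    (abs_le.1 h1).2
  nlinarith [(abs_le.1 h2).2]

/-! ### Summation by parts -/

/-- Abel summation, by induction: replacing the last value of `f` by a smaller one only increases
its product with a nonpositive partial sum. -/
theorem sum_range_mul_le_of_antitone {f e : ℕ → ℝ} (n : ℕ)
    (hf : ∀ i, i + 1 < n → f (i + 1) ≤ f i) (he : ∀ k < n, ∑ i ∈ Finset.range k, e i ≤ 0) :
    ∑ i ∈ Finset.range n, f i * e i ≤ f (n - 1) * ∑ i ∈ Finset.range n, e i := by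
  induction n with
  | zero => simp
  | succ n ih =>
    have h := ih (fun i hi => hf i (by omega)) (fun k hk => he k (by omega))
    rw [Finset.sum_range_succ, Finset.sum_range_succ, Nat.add_sub_cancel, mul_add]
    rcases Nat.eq_zero_or_pos n with rfl | hn
    · simp
    · have h1 := hf (n - 1) (by omega)
      rw [Nat.sub_add_cancel hn] at h1
      nlinarith [he n (by omega)]

theorem sum_fin_eq_sum_range_extend {n : ℕ} (g : Fin n → ℝ) {k : ℕ} (hk : k ≤ n) :
    ∑ i ∈ Finset.range k, (if h : i < n then g ⟨i, h⟩ else 0) =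
      ∑ i : Fin n with i.val < k, g i := by
  rw [Finset.sum_filter]
  have := Fin.sum_univ_eq_sum_range
    (fun i => if i < k then (if h : i < n then g ⟨i, h⟩ else 0) else 0) n
  simp only [Fin.is_lt, dite_true, Fin.eta] at this
  rw [this, ← Finset.sum_filter]
  congr 1
  ext i
  simp
  omega

theorem sum_mul_nonpos_of_antitone {n : ℕ} {f e : Fin n → ℝ} (hf : Antitone f)
    (he : ∀ k < n, ∑ i : Fin n with i.val < k, e i ≤ 0) (he0 : ∑ i, e i = 0) :
    ∑ i, f i * e i ≤ 0 := by
  have h := sum_range_mul_le_of_antitone (f := fun i => if h : i < n then f ⟨i, h⟩ else 0)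
    (e := fun i => if h : i < n then e ⟨i, h⟩ else 0) n
    (fun i hi => by
      simp only [hi, dite_true, (Nat.lt_succ_self i).trans hi]
      exact hf (Fin.mk_le_mk.2 (Nat.le_succ i)))
    (fun k hk => by rw [sum_fin_eq_sum_range_extend _ hk.le]; exact he k hk)
  rw [sum_fin_eq_sum_range_extend _ le_rfl] at h
  simp only [Fin.is_lt, Finset.filter_true, he0, mul_zero] at h
  refine le_trans (le_of_eq ?_) h
  rw [Finset.sum_range]
  simp

/-! ### Allocation vectors -/

/-- The sign of the upper half minus the lower half of `Fin n`. -/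
def halfSign (n : ℕ) (i : ℕ) : ℝ :=
  if 2 * i + 2 ≤ n then 1 else if n ≤ 2 * i then -1 else 0

theorem sum_range_halfSign {n k : ℕ} (hk : k ≤ n) :
    ∑ i ∈ Finset.range k, halfSign n i = min (k : ℝ) (n - k) := by
  induction k with
  | zero => simp
  | succ k ih =>
    have hk' : (k : ℝ) + 1 ≤ n := by exact_mod_cast hk
    rw [Finset.sum_range_succ, ih (by omega), halfSign]
    push_cast
    split_ifs with h1 h2
    · have : 2 * (k : ℝ) + 2 ≤ n := by exact_mod_cast h1
      rw [min_eq_left (by linarith), min_eq_left (by linarith)]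
    · have : (n : ℝ) ≤ 2 * k := by exact_mod_cast h2
      rw [min_eq_right (by linarith), min_eq_right (by linarith)]
      ring
    · have : n = 2 * k + 1 := by omega
      have : (n : ℝ) = 2 * k + 1 := by exact_mod_cast this
      rw [min_eq_left (by linarith), min_eq_right (by linarith)]
      linarith

theorem sum_filter_halfSign {n k : ℕ} (hk : k ≤ n) :
    ∑ i : Fin n with i.val < k, halfSign n i = min (k : ℝ) (n - k) := by
  rw [← sum_range_halfSign hk, ← sum_fin_eq_sum_range_extend _ hk]
  refine Finset.sum_congr rfl fun i hi => ?_
  rw [dif_pos ((Finset.mem_range.1 hi).trans_le hk)]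

theorem sum_halfSign (n : ℕ) : ∑ i : Fin n, halfSign n i = 0 := by
  have := sum_filter_halfSign (le_refl n)
  simpa using this

theorem isMedianSign_halfSign {n : ℕ} (hn : 0 < n) {u : Fin n → ℝ} (hu : Antitone u) :
    IsMedianSign (fun i : Fin n => halfSign n i) u (u ⟨n / 2, by omega⟩) := by
  intro i
  simp only [halfSign]
  split_ifs with h1 h2
  · exact Or.inl ⟨rfl, hu (Fin.le_def.2 (by simp only; omega))⟩
  · exact Or.inr (Or.inl ⟨rfl, hu (Fin.le_def.2 (by simp only; omega))⟩)
  · refine Or.inr (Or.inr ⟨rfl, congrArg u (Fin.ext ?_)⟩)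
    simp only
    omega

/-- Merges both halves of `C₁` into one tent-shaped gap, namely the prefix sums of `halfSign`. Up to
`δ n` one loses `ε ≥ δε`; beyond it, `δ / (1 - δ) ≥ δ`. -/
theorem CondC1.sum_filter_le {n : ℕ} {δ ε : ℝ} (hδ : δ ∈ Set.Ioo (0 : ℝ) 1)
    (hε : ε ∈ Set.Ioo (0 : ℝ) 1) {p : Fin n → ℝ} (hp : ∑ i, p i = 1) (h : CondC1 δ ε p)
    {k : ℕ} (hk : k < n) :
    ∑ i : Fin n with i.val < k, p i ≤ k / n - δ * ε / n * min (k : ℝ) (n - k) := by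
  obtain ⟨hδ0, hδ1⟩ := hδ
  obtain ⟨hε0, hε1⟩ := hε
  have hn : (0 : ℝ) < n := by exact_mod_cast (Nat.zero_le k).trans_lt hk
  have hδε := mul_pos hδ0 hε0
  have hk' : (k : ℝ) + 1 ≤ n := by exact_mod_cast hk
  rcases Nat.eq_zero_or_pos k with rfl | hk0
  · simp
  have hk0' : (1 : ℝ) ≤ k := by exact_mod_cast hk0
  have e1 : (k : ℝ) / n - δ * ε / n * min (k : ℝ) (n - k) =
      (k - δ * ε * min (k : ℝ) (n - k)) / n := by ring
  rw [e1, le_div_iff₀ hn]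
  rcases le_total (k : ℝ) (δ * n) with h1 | h1
  · have h2 := h.1 k hk0 h1
    simp only [Nat.succ_le_iff] at h2
    have h3 : (∑ i : Fin n with i.val < k, p i) * n ≤ (1 - ε) * k := by
      calc _ ≤ (1 - ε) * (k / n) * n := mul_le_mul_of_nonneg_right h2 hn.le
        _ = _ := by field_simp
    have h4 : δ * ε * min (k : ℝ) (n - k) ≤ δ * ε * k :=
      mul_le_mul_of_nonneg_left (min_le_left _ _) hδε.le
    nlinarith [mul_pos hε0 (by linarith : (0 : ℝ) < k)]
  -- The complement of the first `k` entries starts at the 1-based rank `k + 1`.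
  · have h2 := h.2 (k + 1) (by push_cast; linarith) hk
    have h3 : ∑ i : Fin n with i.val < k, p i = 1 - ∑ i : Fin n with k + 1 ≤ i.val + 1, p i := by
      rw [← hp, ← Finset.sum_filter_add_sum_filter_not Finset.univ (fun i : Fin n => i.val < k) p]
      simp only [not_lt, add_le_add_iff_right, add_sub_cancel_right]
    push_cast at h2
    have h5 : δ ≤ δ / (1 - δ) := by
      rw [le_div_iff₀ (by linarith)]
      nlinarith
    have h6 : (1 + ε * (δ / (1 - δ))) * (n - k) ≤
        (∑ i : Fin n with k + 1 ≤ i.val + 1, p i) * n := by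
      calc _ = (1 + ε * (δ / (1 - δ))) * (((n : ℝ) - (k + 1) + 1) / n) * n := by
            field_simp
            ring
        _ ≤ _ := by
            simp only [add_le_add_iff_right] at h2 ⊢
            exact mul_le_mul_of_nonneg_right h2 hn.le
    have h4 : δ * ε * min (k : ℝ) (n - k) ≤ δ * ε * (n - k) :=
      mul_le_mul_of_nonneg_left (min_le_right _ _) hδε.le
    have h7 : δ * ε * (n - k) ≤ ε * (δ / (1 - δ)) * (n - k) := by
      rw [mul_comm δ ε]
      exact mul_le_mul_of_nonneg_right (mul_le_mul_of_nonneg_left h5 hε0.le) (by linarith)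
    rw [h3]
    nlinarith

theorem CondC1.sum_mul_le {n : ℕ} (hn : 0 < n) {δ ε : ℝ} (hδ : δ ∈ Set.Ioo (0 : ℝ) 1)
    (hε : ε ∈ Set.Ioo (0 : ℝ) 1) {p : Fin n → ℝ} (hp : ∑ i, p i = 1) (h : CondC1 δ ε p)
    {f : Fin n → ℝ} (hf : Antitone f) :
    ∑ i, f i * (p i - 1 / n) ≤ -(δ * ε / n) * ∑ i : Fin n, halfSign n i * f i := by
  have hn' : (n : ℝ) ≠ 0 := by positivity
  have := sum_mul_nonpos_of_antitone (e := fun i => p i - 1 / n + δ * ε / n * halfSign n i) hf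
    (fun k hk => by
      rw [Finset.sum_add_distrib, Finset.sum_sub_distrib, ← Finset.mul_sum,
        sum_filter_halfSign hk.le]
      have h1 := h.sum_filter_le hδ hε hp hk
      have h2 : ∑ i : Fin n with i.val < k, (1 / n : ℝ) = k / n := by
        rw [← sum_fin_eq_sum_range_extend _ hk.le, Finset.sum_congr rfl
          (g := fun _ => (1 / n : ℝ)) (fun i hi =>
            dif_pos ((Finset.mem_range.1 hi).trans hk))]
        simp [div_eq_mul_inv]
      rw [h2]
      linarith)
    (by
      rw [Finset.sum_add_distrib, Finset.sum_sub_distrib, ← Finset.mul_sum, sum_halfSign, hp]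
      simp [hn'])
  rw [Finset.mul_sum]
  have e : ∑ i, f i * (p i - 1 / n + δ * ε / n * halfSign n i) =
      ∑ i, f i * (p i - 1 / n) - ∑ i : Fin n, -(δ * ε / n) * (halfSign n i * f i) := by
    rw [← Finset.sum_sub_distrib]
    exact Finset.sum_congr rfl fun i _ => by ring
  linarith

/-- If some probability vector satisfies both conditions then the bias is small. -/
theorem CondC1.bias_le {n : ℕ} (hn : 2 ≤ n) {δ ε C : ℝ} (hδ : δ ∈ Set.Ioo (0 : ℝ) 1)
    (hε : ε ∈ Set.Ioo (0 : ℝ) 1) {p : Fin n → ℝ} (hp : ∑ i, p i = 1) (h : CondC1 δ ε p)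
    (h' : CondC3 C p) : δ * ε ≤ C - 1 := by
  have hn' : (2 : ℝ) ≤ n := by exact_mod_cast hn
  have h1 := h.sum_filter_le hδ hε hp (k := 1) (by omega)
  have h2 := h' ⟨0, by omega⟩
  have h3 : ∑ i : Fin n with i.val < 1, p i = p ⟨0, by omega⟩ := by
    rw [← sum_fin_eq_sum_range_extend _ (by omega), Finset.sum_range_one, dif_pos (by omega)]
  rw [h3, Nat.cast_one, min_eq_left (by linarith), mul_one] at h1
  have h4 : δ * ε / n ≤ (C - 1) / n := by linarith [(abs_le.1 h2).1]
  rwa [div_le_div_iff_of_pos_right (by linarith)] at h4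

theorem sum_cosh_drift {n : ℕ} (hn : 0 < n) {δ ε : ℝ} (hδ : δ ∈ Set.Ioo (0 : ℝ) 1)
    (hε : ε ∈ Set.Ioo (0 : ℝ) 1) {p : Fin n → ℝ} (hp : ∑ i, p i = 1) (h : CondC1 δ ε p)
    {u : Fin n → ℝ} (hu : Antitone u) (hu0 : ∑ i, u i = 0) :
    ∑ i, 2 * Real.sinh (u i) * (p i - 1 / n) ≤
      -(δ * ε / (2 * n)) * ∑ i, 2 * Real.cosh (u i) + δ * ε := by
  have hn' : (0 : ℝ) < n := by exact_mod_cast hn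
  have h1 := h.sum_mul_le hn hδ hε hp (f := fun i => Real.sinh (u i))
    (Real.sinh_strictMono.monotone.comp_antitone hu)
  have h2 := (isMedianSign_halfSign hn hu).sum_abs_sinh_le (sum_halfSign n) hu0
  have h3 : ∑ i, 2 * Real.cosh (u i) ≤ 2 * ∑ i, |Real.sinh (u i)| + 2 * n := by
    calc _ ≤ ∑ i : Fin n, (2 * |Real.sinh (u i)| + 2) :=
          Finset.sum_le_sum fun i _ => two_mul_cosh_le _
      _ = _ := by
        rw [Finset.sum_add_distrib, ← Finset.mul_sum]
        simp [mul_comm]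
  have h4 : ∑ i, 2 * Real.sinh (u i) * (p i - 1 / n) =
      2 * ∑ i, Real.sinh (u i) * (p i - 1 / n) := by
    rw [Finset.mul_sum]
    exact Finset.sum_congr rfl fun i _ => by ring
  have h5 : 0 < δ * ε / n := div_pos (mul_pos hδ.1 hε.1) hn'
  have h6 : δ * ε / (2 * n) = δ * ε / n / 2 := by field_simp
  have h7 : δ * ε = δ * ε / n * n := by field_simp
  rw [h4, h6]
  generalize δ * ε / n = a at *
  rw [h7]
  nlinarith

/-! ### Integrating over one batch -/

section Batch

variable {n b : ℕ} {W : Measure ℝ} {Ω : Type*} [mΩ : MeasurableSpace Ω] {μ : Measure Ω}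

/-! ### Disintegration of one batch given the past -/

/-- `condLaw` is this identity on rectangles, and finite product measures are determined by
rectangles. The density is at most `1`, so the reweighted law is finite. -/
theorem BatchedProcess.map_restrict_eq_prod [IsFiniteMeasure μ] [IsProbabilityMeasure W]
    (P : BatchedProcess n b W μ) (r : ℕ) {E : Type*} [MeasurableSpace E] {X : Ω → E}
    (hX : Measurable[P.ℱ r] X) (i : Fin b → Fin n) :
    (μ.restrict {ω | P.bin r ω = i}).map (fun ω => (X ω, P.weight r ω)) =
      ((μ.withDensity fun ω => ∏ j, ENNReal.ofReal (P.p r ω (i j))).map X).prod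
        (Measure.pi fun _ => W) := by
  have hX' : Measurable X := hX.mono (P.ℱ.le r) le_rfl
  have hw : Measurable (P.weight r) := (P.measurable_weight r).mono (P.ℱ.le _) le_rfl
  have hXw : Measurable fun ω => (X ω, P.weight r ω) := hX'.prodMk hw
  have hle : ∀ ω, ∏ j, ENNReal.ofReal (P.p r ω (i j)) ≤ 1 := fun ω =>
    Finset.prod_le_one (fun _ _ => zero_le) fun j _ => by
      rw [ENNReal.ofReal_le_one]
      exact (mem_Icc_of_mem_stdSimplex (P.p_mem r ω) (i j)).2
  have : IsFiniteMeasure (μ.withDensity fun ω => ∏ j, ENNReal.ofReal (P.p r ω (i j))) :=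
    isFiniteMeasure_withDensity ((lintegral_mono hle).trans_lt (by simp)).ne
  symm
  refine Measure.prod_eq fun s t hs ht => ?_
  rw [Measure.map_apply hXw (hs.prod ht), Measure.restrict_apply (hXw (hs.prod ht)),
    Measure.map_apply hX' hs, withDensity_apply _ (hX' hs), ← P.condLaw r _ (hX hs) i t ht]
  congr 1
  ext ω
  simp only [Set.mem_inter_iff, Set.mem_preimage, Set.mem_prod, Set.mem_ofPred_eq]
  tauto

theorem BatchedProcess.lintegral_eq [IsFiniteMeasure μ] [IsProbabilityMeasure W]
    (P : BatchedProcess n b W μ) (r : ℕ) {E : Type*} [MeasurableSpace E] {X : Ω → E}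
    (hX : Measurable[P.ℱ r] X) {G : E → (Fin b → Fin n) → (Fin b → ℝ) → ENNReal}
    (hG : ∀ i, Measurable fun q : E × (Fin b → ℝ) => G q.1 i q.2) :
    ∫⁻ ω, G (X ω) (P.bin r ω) (P.weight r ω) ∂μ =
      ∫⁻ ω, ∑ i : Fin b → Fin n, (∏ j, ENNReal.ofReal (P.p r ω (i j))) *
        ∫⁻ w, G (X ω) i w ∂(Measure.pi fun _ => W) ∂μ := by
  have hX' : Measurable X := hX.mono (P.ℱ.le r) le_rfl
  have hw : Measurable (P.weight r) := (P.measurable_weight r).mono (P.ℱ.le _) le_rfl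
  have hbin : Measurable (P.bin r) := (P.measurable_bin r).mono (P.ℱ.le _) le_rfl
  have hp : Measurable (P.p r) := (P.measurable_p r).mono (P.ℱ.le _) le_rfl
  have hXw : Measurable fun ω => (X ω, P.weight r ω) := hX'.prodMk hw
  have hS : ∀ i, MeasurableSet {ω | P.bin r ω = i} := fun i => hbin (measurableSet_singleton i)
  have hD : ∀ i : Fin b → Fin n, Measurable fun ω => ∏ j, ENNReal.ofReal (P.p r ω (i j)) :=
    fun i => Finset.measurable_fun_prod _ fun j _ =>
      ((measurable_pi_apply (i j)).comp hp).ennreal_ofReal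
  have hI : ∀ i, Measurable fun e => ∫⁻ w, G e i w ∂(Measure.pi fun _ => W) := fun i =>
    (hG i).lintegral_prod_right'
  have hDI : ∀ i : Fin b → Fin n, Measurable fun ω => (∏ j, ENNReal.ofReal (P.p r ω (i j))) *
      ∫⁻ w, G (X ω) i w ∂(Measure.pi fun _ => W) := fun i => (hD i).mul ((hI i).comp hX')
  rw [lintegral_finsetSum _ fun i _ => hDI i]
  have h1 : ∀ ω, G (X ω) (P.bin r ω) (P.weight r ω) =
      ∑ i, Set.indicator {ω | P.bin r ω = i} (fun ω => G (X ω) i (P.weight r ω)) ω := by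
    intro ω
    simp [Set.indicator_apply]
  have hGi : ∀ i, Measurable
      (Set.indicator {ω | P.bin r ω = i} fun ω => G (X ω) i (P.weight r ω)) := fun i =>
    ((hG i).comp hXw).indicator (hS i)
  simp_rw [h1]
  rw [lintegral_finsetSum _ fun i _ => hGi i]
  refine Finset.sum_congr rfl fun i _ => ?_
  rw [lintegral_indicator (hS i), ← lintegral_map (f := fun q => G q.1 i q.2) (hG i) hXw,
    P.map_restrict_eq_prod r hX i, lintegral_prod _ (hG i).aemeasurable,
    lintegral_map (hI i) hX']
  exact lintegral_withDensity_eq_lintegral_mul _ (hD i) ((hI i).comp hX')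

theorem lintegral_pi_prod_ofReal_exp [IsProbabilityMeasure W] (s : Fin b → ℝ) :
    ∫⁻ w : Fin b → ℝ, ∏ j, ENNReal.ofReal (Real.exp (s j * w j)) ∂(Measure.pi fun _ => W) =
      ∏ j, ∫⁻ x, ENNReal.ofReal (Real.exp (s j * x)) ∂W := by
  have hm : ∀ j, Measurable fun x : ℝ => ENNReal.ofReal (Real.exp (s j * x)) := fun j => by
    fun_prop
  rw [lintegral_prod_eq_prod_lintegral_of_indepFun Finset.univ
    (fun j (w : Fin b → ℝ) => ENNReal.ofReal (Real.exp (s j * w j)))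
    (iIndepFun_pi fun j => (hm j).aemeasurable) (fun j => (hm j).comp (measurable_pi_apply j))]
  refine Finset.prod_congr rfl fun j _ => ?_
  rw [← (measurePreserving_eval (fun _ : Fin b => W) j).lintegral_comp (hm j)]

/-- The change of entry `l`, per unit of weight, when a ball goes to entry `a`. -/
noncomputable def ballShift {n : ℕ} (l a : Fin n) : ℝ := (if a = l then 1 else 0) - 1 / n

theorem batchUpdate_eq (y : Fin n → ℝ) (i : Fin b → Fin n) (w : Fin b → ℝ) (l : Fin n) :
    batchUpdate y i w l = y l + ∑ j, ballShift l (i j) * w j := by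
  simp only [batchUpdate, ballShift, sub_mul, ite_mul, one_mul, zero_mul, Finset.sum_sub_distrib,
    Finset.mul_sum]
  ring

theorem BatchedProcess.lintegral_exp_batchUpdate [IsFiniteMeasure μ] [IsProbabilityMeasure W]
    (P : BatchedProcess n b W μ) (r : ℕ) (c : ℝ) (l : Fin n) :
    ∫⁻ ω, ENNReal.ofReal (Real.exp (c * batchUpdate (P.y r ω) (P.bin r ω) (P.weight r ω) l)) ∂μ =
      ∫⁻ ω, ENNReal.ofReal (Real.exp (c * P.y r ω l)) *
        (∑ a, ENNReal.ofReal (P.p r ω a) *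
          ∫⁻ x, ENNReal.ofReal (Real.exp (c * ballShift l a * x)) ∂W) ^ b ∂μ := by
  have hfac : ∀ (y : Fin n → ℝ) (i : Fin b → Fin n) (w : Fin b → ℝ),
      ENNReal.ofReal (Real.exp (c * batchUpdate y i w l)) =
        ENNReal.ofReal (Real.exp (c * y l)) *
          ∏ j, ENNReal.ofReal (Real.exp (c * ballShift l (i j) * w j)) := by
    intro y i w
    rw [batchUpdate_eq, mul_add, Real.exp_add, ENNReal.ofReal_mul (Real.exp_nonneg _),
      Finset.mul_sum, Real.exp_sum, ENNReal.ofReal_prod_of_nonneg fun _ _ => Real.exp_nonneg _]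
    simp only [mul_assoc]
  simp_rw [hfac]
  rw [P.lintegral_eq r (P.measurable_y r) (G := fun y i w => ENNReal.ofReal (Real.exp (c * y l)) *
          ∏ j, ENNReal.ofReal (Real.exp (c * ballShift l (i j) * w j)))
      (fun i => by fun_prop)]
  refine lintegral_congr fun ω => ?_
  have h1 : ∀ i : Fin b → Fin n, ∫⁻ w : Fin b → ℝ, ENNReal.ofReal (Real.exp (c * P.y r ω l)) *
      ∏ j, ENNReal.ofReal (Real.exp (c * ballShift l (i j) * w j)) ∂(Measure.pi fun _ => W) =
      ENNReal.ofReal (Real.exp (c * P.y r ω l)) *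
        ∏ j, ∫⁻ x, ENNReal.ofReal (Real.exp (c * ballShift l (i j) * x)) ∂W := by
    intro i
    rw [lintegral_const_mul _ (by fun_prop),
      lintegral_pi_prod_ofReal_exp fun j => c * ballShift l (i j)]
  simp_rw [h1]
  -- Expanding the `b`-th power of the sum over bins gives the sum over all placements of the batch.
  rw [← Fin.prod_const, Finset.prod_univ_sum, Fintype.piFinset_univ, Finset.mul_sum]
  refine Finset.sum_congr rfl fun i _ => ?_
  rw [Finset.prod_mul_distrib]
  ring

end Batch

/-! ### Exponential moment of a single ball -/

theorem FiniteMgf.lintegral_exp_le {S : ℝ} {W : Measure ℝ} (hS : 1 ≤ S) (h : FiniteMgf S W)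
    {γ : ℝ} (hγ : 0 < γ) (hγS : γ < 1 / (2 * S)) {κ : ℝ} (hκ : κ ∈ Set.Icc (-1 : ℝ) 1) :
    ∫⁻ x, ENNReal.ofReal (Real.exp (γ * κ * x)) ∂W ≤
      ENNReal.ofReal (1 + γ * κ + S * γ ^ 2 * κ ^ 2) := by
  obtain ⟨ζ, hζ, hint, hmax, hmom⟩ := h.moment_bound
  have hS0 : 0 < S := by linarith
  have h1 : γ < ζ / 2 := by
    have : 1 / S ≤ ζ := by
      rw [div_le_comm₀ hS0 hζ]
      exact (le_max_right _ _).trans hmax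
    have e : 1 / (2 * S) = 1 / S / 2 := by field_simp
    linarith
  have h2 : γ < 1 := by
    have : 1 / (2 * S) ≤ 1 := by
      rw [div_le_one (by positivity)]
      linarith
    linarith
  have hle : γ * κ ≤ ζ := by nlinarith [hκ.2]
  -- Without integrability `mgf` would take the default value `0` and its bound would say nothing
  -- about the lower integral.
  have hint' : Integrable (fun x => Real.exp (γ * κ * x)) W := by
    refine hint.mono' (by fun_prop) ?_
    filter_upwards [h.nonneg] with x hx
    rw [Real.norm_eq_abs, Real.abs_exp]
    exact Real.exp_le_exp.2 (mul_le_mul_of_nonneg_right hle hx)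
  rw [← ofReal_integral_eq_lintegral_ofReal hint' (Filter.Eventually.of_forall fun x =>
    Real.exp_nonneg _)]
  exact ENNReal.ofReal_le_ofReal (hmom γ hγ (lt_min h1 h2) κ hκ)

theorem ballShift_mem_Icc {n : ℕ} (l a : Fin n) : ballShift l a ∈ Set.Icc (-1 : ℝ) 1 := by
  have hn : (1 : ℝ) ≤ n := by exact_mod_cast Nat.one_le_iff_ne_zero.2 (NeZero.of_pos l.pos).out
  have h1 : 1 / (n : ℝ) ≤ 1 := by
    rw [div_le_one (by linarith)]
    exact hn
  have h0 : 0 ≤ 1 / (n : ℝ) := by positivity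
  unfold ballShift
  split_ifs <;> constructor <;> linarith

theorem sum_mul_moment_bound_le {n : ℕ} {p : Fin n → ℝ} (hp : p ∈ stdSimplex ℝ (Fin n)) {C S : ℝ}
    (hC : 1 ≤ C) (hS : 1 ≤ S) (h : CondC3 C p) (c : ℝ) (l : Fin n) :
    ∑ a, p a * (1 + c * ballShift l a + S * c ^ 2 * ballShift l a ^ 2) ≤
      1 + c * (p l - 1 / n) + 2 * C * S * c ^ 2 / n := by
  have hn : (1 : ℝ) ≤ n := by exact_mod_cast Nat.one_le_iff_ne_zero.2 (NeZero.of_pos l.pos).out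
  have hn0 : (0 : ℝ) < n := by linarith
  have e1 : ∑ a, p a * ballShift l a = p l - 1 / n := by
    simp [ballShift, mul_sub, Finset.sum_sub_distrib, ← Finset.sum_mul, hp.2]
  have e2 : ∑ a, p a * ballShift l a ^ 2 = p l * (1 - 2 / n) + 1 / n ^ 2 := by
    have : ∀ a, p a * ballShift l a ^ 2 =
        (if a = l then p a * (1 - 2 / n) else 0) + p a * (1 / n ^ 2) := by
      intro a
      unfold ballShift
      split_ifs <;> ring
    simp_rw [this, Finset.sum_add_distrib, ← Finset.sum_mul, hp.2]
    simp
  have e3 : ∑ a, p a * (1 + c * ballShift l a + S * c ^ 2 * ballShift l a ^ 2) =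
      1 + c * (p l - 1 / n) + S * c ^ 2 * (p l * (1 - 2 / n) + 1 / n ^ 2) := by
    have : ∀ a, p a * (1 + c * ballShift l a + S * c ^ 2 * ballShift l a ^ 2) =
        p a + c * (p a * ballShift l a) + S * c ^ 2 * (p a * ballShift l a ^ 2) := fun a => by ring
    simp_rw [this, Finset.sum_add_distrib, ← Finset.mul_sum, e1, e2, hp.2]
  have h1 : p l ≤ C / n := by
    have := (abs_le.1 (h l)).2
    have e : C / n = (C - 1) / n + 1 / n := by ring
    linarith
  have h2 : p l * (1 - 2 / n) + 1 / n ^ 2 ≤ 2 * C / n := by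
    have h3 : p l * (1 - 2 / n) ≤ p l := by
      have : 0 ≤ p l * (2 / n) := mul_nonneg (hp.1 l) (by positivity)
      linarith
    have h4 : 1 / (n : ℝ) ^ 2 ≤ C / n := by
      rw [div_le_div_iff₀ (by positivity) hn0]
      nlinarith [mul_le_mul_of_nonneg_right hC hn0.le]
    have e : 2 * C / n = C / n + C / n := by ring
    linarith
  rw [e3]
  have h5 := mul_le_mul_of_nonneg_left h2 (by positivity : 0 ≤ S * c ^ 2)
  have e : S * c ^ 2 * (2 * C / n) = 2 * C * S * c ^ 2 / n := by ring
  linarith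

theorem FiniteMgf.sum_ofReal_mul_lintegral_le {n : ℕ} {p : Fin n → ℝ}
    (hp : p ∈ stdSimplex ℝ (Fin n)) {C S : ℝ} {W : Measure ℝ}
    (hC : 1 ≤ C) (hS : 1 ≤ S) (hW : FiniteMgf S W) (h : CondC3 C p) {c : ℝ} (hc : c ≠ 0)
    (hcS : |c| < 1 / (2 * S)) (l : Fin n) :
    ∑ a, ENNReal.ofReal (p a) * ∫⁻ x, ENNReal.ofReal (Real.exp (c * ballShift l a * x)) ∂W ≤
      ENNReal.ofReal (Real.exp (c * (p l - 1 / n) + 2 * C * S * c ^ 2 / n)) := by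
  -- The moment bound needs a positive `γ`, so a negative `c` passes its sign to `κ`.
  have hM : ∀ a, ∫⁻ x, ENNReal.ofReal (Real.exp (c * ballShift l a * x)) ∂W ≤
      ENNReal.ofReal (1 + c * ballShift l a + S * c ^ 2 * ballShift l a ^ 2) := by
    intro a
    have hκ := ballShift_mem_Icc l a
    rcases abs_choice c with hc' | hc'
    · rw [hc'] at hcS
      exact hW.lintegral_exp_le hS (by rw [← hc']; exact abs_pos.2 hc) hcS hκ
    · rw [hc'] at hcS
      have := hW.lintegral_exp_le hS (by rw [← hc']; exact abs_pos.2 hc) hcS (κ := -ballShift l a)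
        ⟨by linarith [hκ.2], by linarith [hκ.1]⟩
      simpa only [neg_mul_neg, neg_sq] using this
  have hnn : ∀ a, 0 ≤ 1 + c * ballShift l a + S * c ^ 2 * ballShift l a ^ 2 := by
    intro a
    have : 0 ≤ (1 + c * ballShift l a / 2) ^ 2 := sq_nonneg _
    nlinarith [mul_nonneg (by linarith : 0 ≤ S - 1) (sq_nonneg (c * ballShift l a)),
      sq_nonneg (c * ballShift l a)]
  calc _ ≤ ∑ a, ENNReal.ofReal (p a * (1 + c * ballShift l a + S * c ^ 2 * ballShift l a ^ 2)) := by
        refine Finset.sum_le_sum fun a _ => ?_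
        rw [ENNReal.ofReal_mul (hp.1 a)]
        exact mul_le_mul_right (hM a) _
    _ = ENNReal.ofReal
          (∑ a, p a * (1 + c * ballShift l a + S * c ^ 2 * ballShift l a ^ 2)) :=
        (ENNReal.ofReal_sum_of_nonneg fun a _ => mul_nonneg (hp.1 a) (hnn a)).symm
    _ ≤ _ := by
        refine ENNReal.ofReal_le_ofReal ((sum_mul_moment_bound_le hp hC hS h c l).trans ?_)
        have := Real.add_one_le_exp (c * (p l - 1 / n) + 2 * C * S * c ^ 2 / n)
        linarith

/-! ### The hyperbolic cosine potential -/

theorem sum_sortDesc {n : ℕ} (g : ℝ → ℝ) (z : Fin n → ℝ) :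
    ∑ i, g (sortDesc z i) = ∑ i, g (z i) :=
  Equiv.sum_comp (Tuple.sort fun j => -z j) fun i => g (z i)

theorem antitone_sortDesc {n : ℕ} (z : Fin n → ℝ) : Antitone (sortDesc z) := fun i j hij => by
  have := Tuple.monotone_sort (fun j => -z j) hij
  simp only [Function.comp_apply, neg_le_neg_iff] at this
  exact this

theorem sum_batchUpdate {n b : ℕ} (hn : 0 < n) (y : Fin n → ℝ) (i : Fin b → Fin n)
    (w : Fin b → ℝ) : ∑ l, batchUpdate y i w l = ∑ l, y l := by
  have hn' : (n : ℝ) ≠ 0 := by positivity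
  simp only [batchUpdate, Finset.sum_sub_distrib, Finset.sum_add_distrib]
  rw [Finset.sum_comm]
  simp
  field_simp
  ring

section Potential

variable {n b : ℕ} {W : Measure ℝ} {Ω : Type*} [mΩ : MeasurableSpace Ω] {μ : Measure Ω}

theorem BatchedProcess.antitone_y (P : BatchedProcess n b W μ) (r : ℕ) (ω : Ω) :
    Antitone (P.y r ω) := by
  cases r with
  | zero => rw [P.y_zero]; exact antitone_const
  | succ r => rw [P.y_succ]; exact antitone_sortDesc _

theorem BatchedProcess.sum_y (P : BatchedProcess n b W μ) (hn : 0 < n) (r : ℕ) (ω : Ω) :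
    ∑ i, P.y r ω i = 0 := by
  induction r with
  | zero => simp [P.y_zero]
  | succ r ih => 
    rw [P.y_succ, ← ih, ← sum_batchUpdate hn (P.y r ω) (P.bin r ω) (P.weight r ω)]
    exact sum_sortDesc id _

/-- The hyperbolic cosine potential. -/
noncomputable def coshPotential {n : ℕ} (γ : ℝ) (y : Fin n → ℝ) : ℝ :=
  ∑ i, 2 * Real.cosh (γ * y i)

theorem coshPotential_sortDesc {n : ℕ} (γ : ℝ) (z : Fin n → ℝ) :
    coshPotential γ (sortDesc z) = coshPotential γ z :=
  sum_sortDesc (fun x => 2 * Real.cosh (γ * x)) z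

theorem coshPotential_nonneg {n : ℕ} (γ : ℝ) (y : Fin n → ℝ) : 0 ≤ coshPotential γ y :=
  Finset.sum_nonneg fun _ _ => by positivity

theorem exp_mul_abs_le_coshPotential {n : ℕ} {γ : ℝ} (hγ : 0 ≤ γ) (y : Fin n → ℝ) (i : Fin n) :
    Real.exp (γ * |y i|) ≤ coshPotential γ y := by
  have h1 : 2 * Real.cosh (γ * y i) ≤ coshPotential γ y :=
    Finset.single_le_sum (f := fun i => 2 * Real.cosh (γ * y i)) (fun _ _ => by positivity)
      (Finset.mem_univ i)
  have h2 : Real.cosh (γ * |y i|) = Real.cosh (γ * y i) := by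
    rw [← Real.cosh_abs (γ * y i), abs_mul, abs_of_nonneg hγ]
  rw [← h2, Real.cosh_eq] at h1
  linarith [Real.exp_pos (-(γ * |y i|))]

theorem ofReal_coshPotential {n : ℕ} (γ : ℝ) (y : Fin n → ℝ) :
    ENNReal.ofReal (coshPotential γ y) = ∑ i, (ENNReal.ofReal (Real.exp (γ * y i)) +
      ENNReal.ofReal (Real.exp (-γ * y i))) := by
  rw [coshPotential, ENNReal.ofReal_sum_of_nonneg fun _ _ => by positivity]
  refine Finset.sum_congr rfl fun i _ => ?_
  rw [← ENNReal.ofReal_add (Real.exp_nonneg _) (Real.exp_nonneg _), Real.cosh_eq]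
  congr 1
  ring_nf

theorem measurable_coshPotential {n : ℕ} (γ : ℝ) :
    Measurable (coshPotential γ : (Fin n → ℝ) → ℝ) := by
  unfold coshPotential
  fun_prop

/-- The bounds satisfied by the smoothing parameter `γ`, in terms of `η = γ * b / n`. -/
structure SmoothingBounds (n b : ℕ) (a C S γ η : ℝ) : Prop where
  pos : 0 < γ
  lt : γ < 1 / (2 * S)
  b_mul : b * γ = η * n
  scale_nonneg : 0 ≤ η * (C - 1)
  scale_le : η * (C - 1) ≤ 1 / 2
  sq_le : 16 * (η * (C - 1)) ^ 2 ≤ η * a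
  variance_le : b * (2 * C * S * γ ^ 2 / n) ≤ (η * (C - 1)) ^ 2
  drift_nonneg : 0 ≤ η * a
  drift_le : η * a ≤ 4

theorem SmoothingBounds.exp_factor_le {a C S γ η : ℝ} (hn : 0 < n)
    (h : SmoothingBounds n b a C S γ η) {d σ : ℝ} (hd : |d| ≤ (C - 1) / n) (hσ : |σ| = 1) :
    Real.exp (σ * γ * d + 2 * C * S * (σ * γ) ^ 2 / n) ^ b ≤
      1 + σ * (b * γ * d) + 4 * (η * (C - 1)) ^ 2 := by
  have hn' : (0 : ℝ) < n := by exact_mod_cast hn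
  have hσ2 : σ ^ 2 = 1 := by rw [← sq_abs, hσ, one_pow]
  have hη : 0 ≤ b * γ := mul_nonneg (Nat.cast_nonneg _) h.pos.le
  have hu : |σ * (b * γ * d)| ≤ η * (C - 1) := by
    rw [abs_mul, hσ, one_mul, abs_mul, abs_of_nonneg hη]
    refine (mul_le_mul_of_nonneg_left hd hη).trans (le_of_eq ?_)
    rw [h.b_mul]
    field_simp
  rw [← Real.exp_nat_mul]
  refine le_trans (Real.exp_le_exp.2 ?_) (exp_add_sq_le h.scale_le hu)
  have := h.variance_le
  rw [mul_pow, hσ2, one_mul, mul_add]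
  linarith

/-- The `sinh` drift contributes `-(ηa/2) Γ + ηa n` with `a = δε`; the second-order term consumes at
most `(ηa/4) Γ` of the decrease. -/
theorem SmoothingBounds.potential_drift {δ ε C S γ η : ℝ} (hn : 0 < n)
    (hδ : δ ∈ Set.Ioo (0 : ℝ) 1) (hε : ε ∈ Set.Ioo (0 : ℝ) 1)
    (h : SmoothingBounds n b (δ * ε) C S γ η) {p : Fin n → ℝ} (hp : ∑ i, p i = 1)
    (h1 : CondC1 δ ε p) {y : Fin n → ℝ} (hy : Antitone y) (hy0 : ∑ i, y i = 0) :
    ∑ l, (Real.exp (γ * y l) * (1 + 1 * (b * γ * (p l - 1 / n)) + 4 * (η * (C - 1)) ^ 2) +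
      Real.exp (-γ * y l) * (1 + -1 * (b * γ * (p l - 1 / n)) + 4 * (η * (C - 1)) ^ 2)) ≤
      (1 - η * (δ * ε) / 4) * coshPotential γ y + η * (δ * ε) * n := by
  have hn' : (0 : ℝ) < n := by exact_mod_cast hn
  have hdrift := sum_cosh_drift hn hδ hε hp h1 (u := fun i => γ * y i)
    (fun i j hij => mul_le_mul_of_nonneg_left (hy hij) h.pos.le)
    (by rw [← Finset.mul_sum, hy0, mul_zero])
  have e : ∑ l, (Real.exp (γ * y l) * (1 + 1 * (b * γ * (p l - 1 / n)) + 4 * (η * (C - 1)) ^ 2) +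
      Real.exp (-γ * y l) * (1 + -1 * (b * γ * (p l - 1 / n)) + 4 * (η * (C - 1)) ^ 2)) =
      (1 + 4 * (η * (C - 1)) ^ 2) * coshPotential γ y +
        b * γ * ∑ l, 2 * Real.sinh (γ * y l) * (p l - 1 / n) := by
    rw [coshPotential, Finset.mul_sum, Finset.mul_sum, ← Finset.sum_add_distrib]
    refine Finset.sum_congr rfl fun l _ => ?_
    rw [Real.cosh_eq, Real.sinh_eq, neg_mul]
    ring
  have h2 := mul_le_mul_of_nonneg_left hdrift
    (mul_nonneg (Nat.cast_nonneg b) h.pos.le : (0 : ℝ) ≤ b * γ)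
  have h3 : b * γ * (-(δ * ε / (2 * n)) * ∑ i, 2 * Real.cosh (γ * y i) + δ * ε) =
      -(η * (δ * ε) / 2) * coshPotential γ y + η * (δ * ε) * n := by
    rw [h.b_mul, coshPotential]
    field_simp
  rw [e]
  have h4 := mul_le_mul_of_nonneg_right h.sq_le (coshPotential_nonneg γ y)
  nlinarith

/-! ### Recursion for the expected potential -/

theorem BatchedProcess.lintegral_coshPotential_succ_le [IsFiniteMeasure μ]
    (P : BatchedProcess n b W μ) {δ ε C S γ η : ℝ} (hn : 0 < n)
    (hδ : δ ∈ Set.Ioo (0 : ℝ) 1) (hε : ε ∈ Set.Ioo (0 : ℝ) 1) (hC : 1 ≤ C) (hS : 1 ≤ S)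
    (hW : FiniteMgf S W) (h : SmoothingBounds n b (δ * ε) C S γ η) (r : ℕ)
    (h1 : ∀ᵐ ω ∂μ, CondC1 δ ε (P.p r ω)) (h3 : ∀ᵐ ω ∂μ, CondC3 C (P.p r ω)) :
    ∫⁻ ω, ENNReal.ofReal (coshPotential γ (P.y (r + 1) ω)) ∂μ ≤
      ∫⁻ ω, ENNReal.ofReal
        ((1 - η * (δ * ε) / 4) * coshPotential γ (P.y r ω) + η * (δ * ε) * n) ∂μ := by
  have := hW.isProbabilityMeasure
  have hy : Measurable (P.y r) := (P.measurable_y r).mono (P.ℱ.le _) le_rfl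
  have hp : Measurable (P.p r) := (P.measurable_p r).mono (P.ℱ.le _) le_rfl
  have hw : Measurable (P.weight r) := (P.measurable_weight r).mono (P.ℱ.le _) le_rfl
  have hbin : Measurable (P.bin r) := (P.measurable_bin r).mono (P.ℱ.le _) le_rfl
  have hz : ∀ l, Measurable fun ω => batchUpdate (P.y r ω) (P.bin r ω) (P.weight r ω) l := by
    intro l
    simp only [batchUpdate]
    have hite : ∀ j, Measurable fun ω => if P.bin r ω j = l then P.weight r ω j else 0 := fun j =>
      Measurable.ite (((measurable_pi_apply j).comp hbin) (measurableSet_singleton l))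
        ((measurable_pi_apply j).comp hw) measurable_const
    fun_prop
  have hexp : ∀ (c : ℝ) l, Measurable fun ω => ENNReal.ofReal
      (Real.exp (c * batchUpdate (P.y r ω) (P.bin r ω) (P.weight r ω) l)) := fun c l =>
    ((hz l).const_mul c).exp.ennreal_ofReal
  have hcond : ∀ (c : ℝ) l, Measurable fun ω => ENNReal.ofReal (Real.exp (c * P.y r ω l)) *
        (∑ a, ENNReal.ofReal (P.p r ω a) *
          ∫⁻ x, ENNReal.ofReal (Real.exp (c * ballShift l a * x)) ∂W) ^ b := fun c l => by
    fun_prop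
  have hexp2 : ∀ l, Measurable fun ω => ENNReal.ofReal
        (Real.exp (γ * batchUpdate (P.y r ω) (P.bin r ω) (P.weight r ω) l)) + ENNReal.ofReal
        (Real.exp (-γ * batchUpdate (P.y r ω) (P.bin r ω) (P.weight r ω) l)) := fun l =>
    (hexp γ l).add (hexp (-γ) l)
  have hcond2 : ∀ l, Measurable fun ω => ENNReal.ofReal (Real.exp (γ * P.y r ω l)) *
        (∑ a, ENNReal.ofReal (P.p r ω a) *
          ∫⁻ x, ENNReal.ofReal (Real.exp (γ * ballShift l a * x)) ∂W) ^ b +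
        ENNReal.ofReal (Real.exp (-γ * P.y r ω l)) *
        (∑ a, ENNReal.ofReal (P.p r ω a) *
          ∫⁻ x, ENNReal.ofReal (Real.exp (-γ * ballShift l a * x)) ∂W) ^ b := fun l =>
    (hcond γ l).add (hcond (-γ) l)
  simp_rw [P.y_succ, coshPotential_sortDesc, ofReal_coshPotential]
  rw [lintegral_finsetSum _ fun l _ => hexp2 l]
  have hstep : ∀ l, ∫⁻ ω, (ENNReal.ofReal
        (Real.exp (γ * batchUpdate (P.y r ω) (P.bin r ω) (P.weight r ω) l)) + ENNReal.ofReal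
        (Real.exp (-γ * batchUpdate (P.y r ω) (P.bin r ω) (P.weight r ω) l))) ∂μ =
      ∫⁻ ω, (ENNReal.ofReal (Real.exp (γ * P.y r ω l)) *
        (∑ a, ENNReal.ofReal (P.p r ω a) *
          ∫⁻ x, ENNReal.ofReal (Real.exp (γ * ballShift l a * x)) ∂W) ^ b +
        ENNReal.ofReal (Real.exp (-γ * P.y r ω l)) *
        (∑ a, ENNReal.ofReal (P.p r ω a) *
          ∫⁻ x, ENNReal.ofReal (Real.exp (-γ * ballShift l a * x)) ∂W) ^ b) ∂μ := by
    intro l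
    rw [lintegral_add_left (hexp γ l), lintegral_add_left (hcond γ l),
      P.lintegral_exp_batchUpdate r γ l, P.lintegral_exp_batchUpdate r (-γ) l]
  simp_rw [hstep]
  rw [← lintegral_finsetSum _ fun l _ => hcond2 l]
  refine lintegral_mono_ae ?_
  filter_upwards [h1, h3] with ω h1 h3
  have hsim := P.p_mem r ω
  have hone : ∀ (σ : ℝ) (l : Fin n), |σ| = 1 →
      ENNReal.ofReal (Real.exp (σ * γ * P.y r ω l)) * (∑ a, ENNReal.ofReal (P.p r ω a) *
          ∫⁻ x, ENNReal.ofReal (Real.exp (σ * γ * ballShift l a * x)) ∂W) ^ b ≤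
      ENNReal.ofReal (Real.exp (σ * γ * P.y r ω l) *
        (1 + σ * (b * γ * (P.p r ω l - 1 / n)) + 4 * (η * (C - 1)) ^ 2)) := by
    intro σ l hσ
    have hσ0 : σ ≠ 0 := by
      rintro rfl
      simp at hσ
    have hb := hW.sum_ofReal_mul_lintegral_le hsim hC hS h3 (mul_ne_zero hσ0 h.pos.ne')
      (by rw [abs_mul, hσ, one_mul, abs_of_pos h.pos]; exact h.lt) l
    rw [ENNReal.ofReal_mul (Real.exp_nonneg _)]
    refine mul_le_mul_right ((pow_le_pow_left' hb b).trans ?_) _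
    rw [← ENNReal.ofReal_pow (Real.exp_nonneg _)]
    exact ENNReal.ofReal_le_ofReal (h.exp_factor_le hn (h3 l) hσ)
  -- The bracket is nonnegative because it dominates a power of an exponential.
  have hnn : ∀ (σ : ℝ) (l : Fin n), |σ| = 1 → 0 ≤ Real.exp (σ * γ * P.y r ω l) *
        (1 + σ * (b * γ * (P.p r ω l - 1 / n)) + 4 * (η * (C - 1)) ^ 2) := fun σ l hσ =>
    mul_nonneg (Real.exp_nonneg _)
      ((pow_nonneg (Real.exp_nonneg _) b).trans (h.exp_factor_le hn (h3 l) hσ))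
  have hone1 := fun l => hone 1 l abs_one
  have hone2 := fun l => hone (-1) l (by simp)
  have hnn1 := fun l => hnn 1 l abs_one
  have hnn2 := fun l => hnn (-1) l (by simp)
  rw [one_mul γ] at hone1 hnn1
  rw [neg_one_mul γ] at hone2 hnn2
  refine le_trans (Finset.sum_le_sum fun l _ => add_le_add (hone1 l) (hone2 l)) ?_
  simp_rw [← ENNReal.ofReal_add (hnn1 _) (hnn2 _)]
  rw [← ENNReal.ofReal_sum_of_nonneg fun l _ => add_nonneg (hnn1 l) (hnn2 l)]
  exact ENNReal.ofReal_le_ofReal (h.potential_drift hn hδ hε hsim.2 h1 (P.antitone_y r ω)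
    (P.sum_y hn r ω))

/-- The initial value is `2n`, and `4n` is the fixed point of the recursion; `drift_le` keeps the
contraction factor nonnegative. -/
theorem BatchedProcess.lintegral_coshPotential_le [IsProbabilityMeasure μ]
    (P : BatchedProcess n b W μ) {δ ε C S γ η : ℝ} (hn : 0 < n)
    (hδ : δ ∈ Set.Ioo (0 : ℝ) 1) (hε : ε ∈ Set.Ioo (0 : ℝ) 1) (hC : 1 ≤ C) (hS : 1 ≤ S)
    (hW : FiniteMgf S W) (h : SmoothingBounds n b (δ * ε) C S γ η)
    (h1 : ∀ r, ∀ᵐ ω ∂μ, CondC1 δ ε (P.p r ω)) (h3 : ∀ r, ∀ᵐ ω ∂μ, CondC3 C (P.p r ω)) (r : ℕ) :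
    ∫⁻ ω, ENNReal.ofReal (coshPotential γ (P.y r ω)) ∂μ ≤ ENNReal.ofReal (4 * n) := by
  induction r with
  | zero =>
    simp only [P.y_zero, lintegral_const, measure_univ, mul_one]
    refine ENNReal.ofReal_le_ofReal ?_
    simp [coshPotential]
    have : (0 : ℝ) ≤ n := Nat.cast_nonneg _
    linarith
  | succ r ih =>
    have hy : Measurable (P.y r) := (P.measurable_y r).mono (P.ℱ.le _) le_rfl
    have hα : 0 ≤ 1 - η * (δ * ε) / 4 := by linarith [h.drift_le]
    have hβ : 0 ≤ η * (δ * ε) * n := mul_nonneg h.drift_nonneg (Nat.cast_nonneg _)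
    refine (P.lintegral_coshPotential_succ_le hn hδ hε hC hS hW h r (h1 r) (h3 r)).trans ?_
    simp_rw [ENNReal.ofReal_add (mul_nonneg hα (coshPotential_nonneg γ _)) hβ,
      ENNReal.ofReal_mul hα]
    have hΓ : Measurable fun ω => ENNReal.ofReal (coshPotential γ (P.y r ω)) :=
      ((measurable_coshPotential γ).comp hy).ennreal_ofReal
    rw [lintegral_add_right _ measurable_const, lintegral_const_mul _ hΓ]
    simp only [lintegral_const, measure_univ, mul_one]
    refine (add_le_add_left (mul_le_mul_right ih _) _).trans (le_of_eq ?_)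
    rw [← ENNReal.ofReal_mul hα, ← ENNReal.ofReal_add (by positivity) hβ]
    congr 1
    ring

/-- The choice `η = a / (16 (C - 1)²)` turns `sq_le` into an equality. The bound `a ≤ C - 1` gives
`η (C - 1) ≤ 1/16`, and the lower bound on `b` gives the variance bound and `γ < 1 / (2S)`. -/
theorem smoothingBounds {a C S : ℝ} (hn : 0 < n) (ha : 0 < a) (ha1 : a < 1) (hC : 1 < C)
    (hS : 1 ≤ S) (hb : 2 * C * S / (C - 1) ^ 2 * n ≤ b) (hbias : a ≤ C - 1) :
    SmoothingBounds n b a C S (a / (16 * (C - 1) ^ 2) * n / b) (a / (16 * (C - 1) ^ 2)) := by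
  have hn' : (0 : ℝ) < n := by exact_mod_cast hn
  obtain ⟨x, rfl⟩ : ∃ x, C = 1 + x := ⟨C - 1, by ring⟩
  have hC1 : 1 + x - 1 = x := add_sub_cancel_left 1 x
  have hx : 0 < x := by linarith
  have hS0 : 0 < S := by linarith
  rw [hC1] at hb hbias
  have hb' : 2 * (1 + x) * S * n ≤ b * x ^ 2 := by
    rwa [div_mul_eq_mul_div, div_le_iff₀ (by positivity)] at hb
  have hb0 : (0 : ℝ) < b := lt_of_lt_of_le (by positivity) hb
  have hηx : a / (16 * x ^ 2) * x = a / (16 * x) := by field_simp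
  have hηx' : a / (16 * x) ≤ 1 / 16 := by
    rw [div_le_div_iff₀ (by positivity) (by norm_num)]
    linarith
  have hηx0 : 0 < a / (16 * x) := by positivity
  constructor <;> simp only [hC1]
  · positivity
  · rw [div_mul_eq_mul_div, div_div, div_lt_div_iff₀ (by positivity) (by positivity)]
    have : a * n * (2 * S) < 1 * (n * (2 * S)) := by
      rw [mul_assoc]
      exact mul_lt_mul_of_pos_right ha1 (by positivity)
    have h2 : 0 < n * S * x := by positivity
    nlinarith
  · field_simp
  · positivity
  · rw [hηx]
    linarith
  · rw [hηx]
    refine le_of_eq ?_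
    field_simp
  · rw [hηx]
    have e : b * (2 * (1 + x) * S * (a / (16 * x ^ 2) * n / b) ^ 2 / n) =
        (a / (16 * x ^ 2)) ^ 2 * (2 * (1 + x) * S * n) / b := by
      field_simp
    rw [e, div_le_iff₀ hb0]
    refine (mul_le_mul_of_nonneg_left hb' (by positivity)).trans (le_of_eq ?_)
    field_simp
  · positivity
  · have h5 : a / (16 * x ^ 2) * a = 16 * (a / (16 * x)) ^ 2 := by
      field_simp
    rw [h5]
    nlinarith

theorem log_four_mul_cube_le (hn : 2 ≤ n) : Real.log (4 * n ^ 3) ≤ 5 * Real.log n := by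
  have hn' : (2 : ℝ) ≤ n := by exact_mod_cast hn
  have e : 5 * Real.log n = Real.log ((n : ℝ) ^ 5) := by
    rw [Real.log_pow]
    norm_num
  rw [e]
  refine Real.log_le_log (by positivity) ?_
  have : (n : ℝ) ^ 5 = n ^ 2 * n ^ 3 := by ring
  rw [this]
  exact mul_le_mul_of_nonneg_right (by nlinarith) (by positivity)

end Potential

/-! ### From the expected potential to the gap -/

theorem theorem3p1 (δ : ℝ) (hδ : δ ∈ Set.Ioo (0 : ℝ) 1) :
    ∃ k : ℝ, 0 < k ∧
      ∀ (n b : ℕ) (ε C S : ℝ) (W : Measure ℝ) (Ω : Type*) [MeasurableSpace Ω] (μ : Measure Ω)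
        [IsProbabilityMeasure μ] (P : BatchedProcess n b W μ),
        1 ≤ n → ε ∈ Set.Ioo (0 : ℝ) 1 → C ∈ Set.Ioo (1 : ℝ) 1.9 → 1 ≤ S → FiniteMgf S W →
        2 * C * S / (C - 1) ^ 2 * n ≤ b →
        (∀ r, ∀ᵐ ω ∂μ, CondC1 δ ε (P.p r ω)) →
        (∀ r, ∀ᵐ ω ∂μ, CondC3 C (P.p r ω)) →
        ∀ r : ℕ,
          1 - ((n : ℝ) ^ 2)⁻¹ ≤
            μ.real {ω | ∀ i, |P.y r ω i| ≤ k * ((C - 1) ^ 2 / ε) * (b / n) * Real.log n} := by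
  obtain ⟨hδ0, hδ1⟩ := hδ
  refine ⟨80 / δ, by positivity, ?_⟩
  intro n b ε C S W Ω _ μ _ P hn hε hC hS hW hb h1 h3 r
  -- For `n = 1` the claimed probability bound is `0`. The bias bound below needs two bins.
  rcases hn.eq_or_lt with rfl | hn2
  · simp
  have hn' : (2 : ℝ) ≤ n := by exact_mod_cast hn2
  have hC0 : 0 < C - 1 := by linarith [hC.1]
  have hε0 := hε.1
  -- A single outcome satisfying both conditions suffices for the deterministic bound `δε ≤ C - 1`.
  obtain ⟨ω₀, hω1, hω3⟩ := ((h1 0).and (h3 0)).exists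
  have hbias := hω1.bias_le hn2 ⟨hδ0, hδ1⟩ hε (P.p_mem 0 ω₀).2 hω3
  have hb0 : (0 : ℝ) < b := lt_of_lt_of_le
    (mul_pos (div_pos (mul_pos (by linarith) (by linarith)) (by positivity)) (by linarith)) hb
  have hγ := smoothingBounds (by omega) (mul_pos hδ0 hε0)
    (mul_lt_one_of_nonneg_of_lt_one_left hδ0.le hδ1 hε.2.le) hC.1 hS hb hbias
  set γ : ℝ := δ * ε / (16 * (C - 1) ^ 2) * n / b with hγdef
  have hE := P.lintegral_coshPotential_le (by omega) ⟨hδ0, hδ1⟩ hε hC.1.le hS hW hγ h1 h3 r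
  have hy : Measurable (P.y r) := (P.measurable_y r).mono (P.ℱ.le _) le_rfl
  have hΓ : Measurable fun ω => ENNReal.ofReal (coshPotential γ (P.y r ω)) :=
    ((measurable_coshPotential γ).comp hy).ennreal_ofReal
  have hbad : μ {ω | ENNReal.ofReal (4 * n ^ 3) ≤ ENNReal.ofReal (coshPotential γ (P.y r ω))} ≤
      ENNReal.ofReal ((n : ℝ) ^ 2)⁻¹ := by
    refine (meas_ge_le_lintegral_div hΓ.aemeasurable ?_ ENNReal.ofReal_ne_top).trans ?_
    · exact (ENNReal.ofReal_pos.2 (by positivity)).ne'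
    · refine (ENNReal.div_le_div_right hE _).trans (le_of_eq ?_)
      rw [← ENNReal.ofReal_div_of_pos (by positivity)]
      congr 1
      field_simp
  set s := {ω | ∀ i, |P.y r ω i| ≤ 80 / δ * ((C - 1) ^ 2 / ε) * (b / n) * Real.log n} with hs
  have hsm : MeasurableSet s := by
    have : s = ⋂ i, {ω | |P.y r ω i| ≤ 80 / δ * ((C - 1) ^ 2 / ε) * (b / n) * Real.log n} := by
      ext ω
      simp [hs]
    rw [this]
    exact MeasurableSet.iInter fun i =>
      measurableSet_le (((measurable_pi_apply i).comp hy).abs) measurable_const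
  have hsub : sᶜ ⊆
      {ω | ENNReal.ofReal (4 * n ^ 3) ≤ ENNReal.ofReal (coshPotential γ (P.y r ω))} := by
    intro ω hω
    by_contra hlt
    refine hω fun i => ?_
    have hlt' : coshPotential γ (P.y r ω) < 4 * n ^ 3 := by
      by_contra hge
      exact hlt (ENNReal.ofReal_le_ofReal (not_lt.1 hge))
    have h4 : γ * |P.y r ω i| ≤ 5 * Real.log n := by
      refine le_trans ?_ (log_four_mul_cube_le hn2)
      rw [Real.le_log_iff_exp_le (by positivity)]
      exact (exp_mul_abs_le_coshPotential hγ.pos.le _ i).trans hlt'.le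
    have h5 : 80 / δ * ((C - 1) ^ 2 / ε) * (b / n) * Real.log n = 5 * Real.log n / γ := by
      rw [hγdef]
      field_simp
      ring
    rw [h5, le_div_iff₀ hγ.pos]
    linarith
  have hfin : μ.real sᶜ ≤ ((n : ℝ) ^ 2)⁻¹ :=
    ENNReal.toReal_le_of_le_ofReal (by positivity) ((measure_mono hsub).trans hbad)
  rw [probReal_compl_eq_one_sub hsm] at hfin
  linarith
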